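/- Let $G$ be a finite simple graph on $n$ vertices with no connected component of order at most two. For a natural number $k$, write $[k]=\{1,\dots,k\}$. An edge coloring $c:E(G)\to\mathcal P([k])\setminus\{\emptyset\}$ is called union vertex-distinguishing if the map $c_\cup$ given by $c_\cup(v)=\bigcup_{uv\in E(G)}c(uv)$ is an injective map from $V(G)$ to $\mathcal P([k])\setminus\{\emptyset\}$. Then $G$ admits a union vertex-distinguishing edge coloring for some $k$, and the smallest such $k$, the union vertex-distinguishing chromatic index $\chi'_\cup(G)$, satisfies $$\chi'_\cup(G)\in\left\{\lceil\log_2(n+1)\rceil,\ \lceil\log_2(n+1)\rceil+1\right\}.$$ -/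

import Mathlib

/-- The union vertex coloring of an edge coloring `c`: a vertex `v` receives the union of the
sets `c (uv)` over all edges `uv` at `v`. -/
def unionVertexColoring {V : Type*} {G : SimpleGraph V} {k : ℕ}
    (c : G.edgeSet → Set (Fin k)) (v : V) : Set (Fin k) :=
  ⋃ (e : G.edgeSet) (_ : v ∈ (e : Sym2 V)), c e

/-- `c` is union vertex-distinguishing: every edge carries a nonempty subset of a `k`-element
set, and the union vertex coloring takes nonempty values and is injective. -/
structure IsUnionVertexDistinguishing {V : Type*} (G : SimpleGraph V) {k : ℕ}
    (c : G.edgeSet → Set (Fin k)) : Prop where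
  edge_nonempty : ∀ e, (c e).Nonempty
  vertex_nonempty : ∀ v, (unionVertexColoring c v).Nonempty
  injective : Function.Injective (unionVertexColoring c)

/-- `G` admits a union vertex-distinguishing edge coloring by nonempty subsets of `[k]`. -/
def HasUnionVertexDistinguishingColoring {V : Type*} (G : SimpleGraph V) (k : ℕ) : Prop :=
  ∃ c : G.edgeSet → Set (Fin k), IsUnionVertexDistinguishing G c

/-- The union vertex-distinguishing chromatic index: the smallest `k` for which `G` admits a
union vertex-distinguishing edge coloring by nonempty subsets of `[k]`. -/
noncomputable def unionVertexDistinguishingIndex {V : Type*} (G : SimpleGraph V) : ℕ :=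
  sInf {k : ℕ | HasUnionVertexDistinguishingColoring G k}

/-! The lower bound is a count: the vertex colors are distinct nonempty subsets of a `k`-set, so `n
< 2 ^ k`. For the upper bound, let `n ≤ 2 ^ m`. It suffices to give the vertices distinct subsets `g
v` of an `m`-set such that every element of `g v` also lies in `g u` for some neighbor `u` of `v`.
Coloring each edge `uv` with `g u ∩ g v` and one extra common element then gives `v` the color `g v`
plus that element.

Such a `g` may be built on a spanning subgraph. A minimal one without small components is a disjoint
union of spiders with legs of length one or two (`exists_spanning_hangsOff`, `exists_isSpider`). A
tower is a family of sets whose inclusions suffice to label every spider of its size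
(`IsTower.exists_labelling`): pairs serve the long legs, and the condition on the last set serves
spiders with exactly one short leg.

It remains to pack disjoint towers of prescribed sizes, of total at most `2 ^ m`, into a power set
(`exists_towerPacking`). This goes by induction on `m`: adjoining a new element doubles a family of
sets, and a doubled tower of size `c` contains a tower of size `2 * c`, or two disjoint ones of odd
sizes with sum `2 * c`. -/

/-! ### Towers and what their doublings contain -/

/-- A tower of size `S`: distinct sets `f 0, …, f (S - 1)`, all contained in `f 0 = f 1 ∪ f 2`, where
the sets from `f 3` on come in pairs `f (2 * j + 1) ⊆ f (2 * j + 2) ⊆ f (2 * j + 1) ∪ f 1`, up to a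
last set contained in `f 2` if `S` is even. -/
structure IsTower (S : ℕ) (f : ℕ → Finset ℕ) : Prop where
  inj : ∀ i < S, ∀ j < S, f i = f j → i = j
  subset_zero : ∀ i < S, f i ⊆ f 0
  zero_subset : 3 ≤ S → f 0 ⊆ f 1 ∪ f 2
  pair_subset : ∀ j, 1 ≤ j → 2 * j + 2 < S → f (2 * j + 1) ⊆ f (2 * j + 2)
  subset_pair : ∀ j, 1 ≤ j → 2 * j + 2 < S → f (2 * j + 2) ⊆ f (2 * j + 1) ∪ f 1
  last_subset : 4 ≤ S → Even S → f (S - 1) ⊆ f 2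

/-- `A` with the new element `e` adjoined if `b` is true. -/
def adjoin (e : ℕ) (A : Finset ℕ) (b : Bool) : Finset ℕ := if b then insert e A else A

theorem adjoin_subset_adjoin {e : ℕ} {A B : Finset ℕ} {b c : Bool} (h : A ⊆ B) (hb : b ≤ c) :
    adjoin e A b ⊆ adjoin e B c := by
  have hb' : b = true → c = true := by revert hb; cases b <;> cases c <;> decide
  intro x hx
  have := @h x
  unfold adjoin at *
  split_ifs at * <;> grind

theorem adjoin_subset_union {e : ℕ} {A B C : Finset ℕ} {b c d : Bool} (h : A ⊆ B ∪ C)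
    (hb : b ≤ (c || d)) : adjoin e A b ⊆ adjoin e B c ∪ adjoin e C d := by
  have hb' : b = true → c = true ∨ d = true := by
    revert hb; cases b <;> cases c <;> cases d <;> decide
  intro x hx
  have := @h x
  unfold adjoin at *
  split_ifs at * <;> grind

theorem adjoin_inj {e : ℕ} {A B : Finset ℕ} {b c : Bool} (hA : e ∉ A) (hB : e ∉ B)
    (h : adjoin e A b = adjoin e B c) : A = B ∧ b = c := by
  cases b <;> cases c <;> simp only [adjoin, if_true, Bool.false_eq_true, if_false] at h
  · exact ⟨h, rfl⟩
  · exact absurd (h ▸ Finset.mem_insert_self e B) hA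
  · exact absurd (h ▸ Finset.mem_insert_self e A) hB
  · exact ⟨by rw [← Finset.erase_insert hA, h, Finset.erase_insert hB], rfl⟩

/-- The part of an adjoined family that follows the index map `p`. -/
def adjoinAlong (e : ℕ) (f : ℕ → Finset ℕ) (p : ℕ → ℕ × Bool) (k : ℕ) : Finset ℕ :=
  adjoin e (f (p k).1) (p k).2

/-- Index map for a tower of even size, or of odd size next to a single set. -/
def verticalIndex (u k : ℕ) : ℕ × Bool :=
  if k = 0 then (0, true) else if k = 1 then (1, true) else if k = 2 then (0, false) else
    if k = 2 * u - 1 then (1, false) else ((k + 1) / 2, k % 2 = 0)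

/-- Index map for the larger of two towers of odd size. -/
def upperIndex (b k : ℕ) : ℕ × Bool :=
  if k < b then (k, true) else (b + (k - b) / 2, (k - b) % 2 = 1)

theorem IsTower.adjoinAlong_inj {S n e : ℕ} {f : ℕ → Finset ℕ} {p : ℕ → ℕ × Bool}
    (hf : IsTower S f) (he : ∀ i < S, e ∉ f i) (hp : ∀ k < n, (p k).1 < S)
    (hinj : ∀ k < n, ∀ l < n, p k = p l → k = l) :
    ∀ k < n, ∀ l < n, adjoinAlong e f p k = adjoinAlong e f p l → k = l := by
  intro k hk l hl h
  obtain ⟨h1, h2⟩ := adjoin_inj (he _ (hp k hk)) (he _ (hp l hl)) h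
  exact hinj k hk l hl (Prod.ext (hf.inj _ (hp k hk) _ (hp l hl) h1) h2)

theorem verticalIndex_inj {u k l : ℕ} (hk : k < 2 * u) (hl : l < 2 * u)
    (h : verticalIndex u k = verticalIndex u l) : k = l := by
  unfold verticalIndex at h
  split_ifs at h <;> simp only [Prod.mk.injEq, decide_eq_decide, reduceCtorEq, and_true, and_false,
    true_eq_decide_iff, decide_eq_true_eq, false_eq_decide_iff, decide_eq_false_iff_not] at h <;>
    omega

theorem verticalIndex_lt {u k : ℕ} (hu : 2 ≤ u) (hk : k < 2 * u) : (verticalIndex u k).1 < u := by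
  unfold verticalIndex
  split_ifs <;> simp only <;> omega

theorem verticalIndex_odd {u j : ℕ} (hj : 1 ≤ j) (hu : j + 1 < u) :
    verticalIndex u (2 * j + 1) = (j + 1, false) := by
  unfold verticalIndex
  rw [if_neg (by omega), if_neg (by omega), if_neg (by omega), if_neg (by omega)]
  refine Prod.ext ?_ ?_
  · simp only
    omega
  · simp

theorem verticalIndex_even {u j : ℕ} (hj : 1 ≤ j) :
    verticalIndex u (2 * j + 2) = (j + 1, true) := by
  unfold verticalIndex
  rw [if_neg (by omega), if_neg (by omega), if_neg (by omega), if_neg (by omega)]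
  refine Prod.ext ?_ ?_
  · simp only
    omega
  · simp

theorem upperIndex_inj {b k l : ℕ} (h : upperIndex b k = upperIndex b l) : k = l := by
  unfold upperIndex at h
  split_ifs at h <;> simp only [Prod.mk.injEq, decide_eq_decide, and_true,
    true_eq_decide_iff, decide_eq_true_eq] at h <;> omega

theorem upperIndex_lt {a b c k : ℕ} (hc : a + b = 2 * c) (hk : k < a) :
    (upperIndex b k).1 < c := by
  unfold upperIndex
  split_ifs <;> simp only <;> omega

/-- The new order is `f 0 + e`, `f 1 + e`, `f 0`, then the pairs `f i`, `f i + e` for `i ≥ 2`, and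
finally `f 1`. A pair differs only by `e`, which lies in the new second set `f 1 + e`. The last set
`f 1` can be dropped, which gives the odd size. -/
theorem IsTower.vertical {u n e : ℕ} {f : ℕ → Finset ℕ} (hf : IsTower u f)
    (he : ∀ i < u, e ∉ f i) (hu : 2 ≤ u) (hn : n = 2 * u ∨ n = 2 * u - 1) :
    IsTower n (adjoinAlong e f (verticalIndex u)) where
  inj := hf.adjoinAlong_inj he (fun k hk => verticalIndex_lt hu (by omega))
    fun k hk l hl => verticalIndex_inj (by omega) (by omega)
  subset_zero i hi := adjoin_subset_adjoin (hf.subset_zero _ (verticalIndex_lt hu (by omega)))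
    (Bool.le_true _)
  zero_subset h := by
    have h1 : verticalIndex u 1 = (1, true) := by simp [verticalIndex]
    have h2 : verticalIndex u 2 = (0, false) := by simp [verticalIndex]
    have h0 : verticalIndex u 0 = (0, true) := by simp [verticalIndex]
    unfold adjoinAlong
    rw [h0, h1, h2]
    exact adjoin_subset_union Finset.subset_union_right (by simp)
  pair_subset j hj hn' := by
    unfold adjoinAlong
    rw [verticalIndex_odd hj (by omega), verticalIndex_even hj]
    exact adjoin_subset_adjoin subset_rfl (by simp)
  subset_pair j hj hn' := by
    have h3 : verticalIndex u 1 = (1, true) := by simp [verticalIndex]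
    unfold adjoinAlong
    rw [verticalIndex_odd hj (by omega), verticalIndex_even hj, h3]
    exact adjoin_subset_union Finset.subset_union_left (by simp)
  last_subset h4 heven := by
    have hn2 : n = 2 * u := by
      obtain ⟨r, hr⟩ := heven
      omega
    have h1 : verticalIndex u (n - 1) = (1, false) := by
      unfold verticalIndex
      rw [if_neg (by omega), if_neg (by omega), if_neg (by omega), if_pos (by omega)]
    have h2 : verticalIndex u 2 = (0, false) := by simp [verticalIndex]
    unfold adjoinAlong
    rw [h1, h2]
    exact adjoin_subset_adjoin (hf.subset_zero 1 (by omega)) le_rfl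

/-- The first `b` sets all receive `e`; each later set occurs without and with `e`, forming a new
pair. Since `b` is odd, no old pair straddles the boundary, and `3 ≤ b` makes the first three sets
receive `e`. Left over are the first `b` sets without `e`, the tower of `IsTower.lower`. -/
theorem IsTower.upper {a b c e : ℕ} {f : ℕ → Finset ℕ} (hf : IsTower c f)
    (he : ∀ i < c, e ∉ f i) (hc : a + b = 2 * c) (hb : 3 ≤ b) (hbo : Odd b) :
    IsTower a (adjoinAlong e f (upperIndex b)) where
  inj := hf.adjoinAlong_inj he (fun k hk => upperIndex_lt hc hk)
    fun k hk l hl => upperIndex_inj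
  subset_zero i hi := by
    have h0 : upperIndex b 0 = (0, true) := by simp [upperIndex]; omega
    unfold adjoinAlong
    rw [h0]
    exact adjoin_subset_adjoin (hf.subset_zero _ (upperIndex_lt hc hi)) (Bool.le_true _)
  zero_subset h := by
    have h0 : upperIndex b 0 = (0, true) := by simp [upperIndex]; omega
    have h1 : upperIndex b 1 = (1, true) := by simp [upperIndex]; omega
    have h2 : upperIndex b 2 = (2, true) := by simp [upperIndex]; omega
    unfold adjoinAlong
    rw [h0, h1, h2]
    exact adjoin_subset_union (hf.zero_subset (by omega)) (by simp)
  pair_subset j hj hn := by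
    obtain ⟨r, hr⟩ := hbo
    unfold adjoinAlong upperIndex
    by_cases hjb : 2 * j + 2 < b
    · rw [if_pos (by omega), if_pos hjb]
      exact adjoin_subset_adjoin (hf.pair_subset j hj (by omega)) le_rfl
    · rw [if_neg (by omega), if_neg hjb]
      have : b + (2 * j + 1 - b) / 2 = b + (2 * j + 2 - b) / 2 := by omega
      simp only [this]
      refine adjoin_subset_adjoin subset_rfl ?_
      have : (2 * j + 2 - b) % 2 = 1 := by omega
      simp [this, Bool.le_true]
  subset_pair j hj hn := by
    obtain ⟨r, hr⟩ := hbo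
    have h1 : upperIndex b 1 = (1, true) := by simp [upperIndex]; omega
    have h3 : adjoinAlong e f (upperIndex b) 1 = adjoin e (f 1) true := by
      unfold adjoinAlong; rw [h1]
    rw [h3]
    unfold adjoinAlong upperIndex
    by_cases hjb : 2 * j + 2 < b
    · rw [if_pos hjb, if_pos (by omega)]
      exact adjoin_subset_union (hf.subset_pair j hj (by omega)) (by simp)
    · rw [if_neg hjb, if_neg (by omega)]
      have : b + (2 * j + 1 - b) / 2 = b + (2 * j + 2 - b) / 2 := by omega
      simp only [this]
      exact adjoin_subset_union Finset.subset_union_left (by simp [Bool.le_true])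
  last_subset _ heven := by
    obtain ⟨r, hr⟩ := hbo
    obtain ⟨q, hq⟩ := heven
    omega

theorem IsTower.lower {b c : ℕ} {f : ℕ → Finset ℕ} (hf : IsTower c f) (hbc : b ≤ c)
    (hbo : Odd b) : IsTower b f where
  inj i hi j hj := hf.inj i (by omega) j (by omega)
  subset_zero i hi := hf.subset_zero i (by omega)
  zero_subset h := hf.zero_subset (by omega)
  pair_subset j hj hn := hf.pair_subset j hj (by omega)
  subset_pair j hj hn := hf.subset_pair j hj (by omega)
  last_subset _ heven := by simp_all [← Nat.not_even_iff_odd]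

theorem isTower_of_le_one {S : ℕ} (hS : S ≤ 1) (f : ℕ → Finset ℕ) : IsTower S f where
  inj i hi j hj _ := by omega
  subset_zero i hi := by
    obtain rfl : i = 0 := by omega
    exact subset_rfl
  zero_subset h := by omega
  pair_subset j hj hn := by omega
  subset_pair j hj hn := by omega
  last_subset _ _ := by omega

/-- The two copies of the family `T`, without and with the new element `e`. -/
def doubled (e : ℕ) (T : Finset (Finset ℕ)) : Finset (Finset ℕ) := T ∪ T.image (insert e)

theorem adjoin_mem_doubled {e : ℕ} {T : Finset (Finset ℕ)} {A : Finset ℕ} (hA : A ∈ T) (b : Bool) :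
    adjoin e A b ∈ doubled e T := by
  cases b <;> simp only [adjoin, doubled, Finset.mem_union, Finset.mem_image] <;> grind

/-- `T` consists of the members of a tower of size `S`. -/
def IsTowerSet (S : ℕ) (T : Finset (Finset ℕ)) : Prop :=
  ∃ f, IsTower S f ∧ T = (Finset.range S).image f

theorem IsTowerSet.even {u e : ℕ} {T : Finset (Finset ℕ)} (hT : IsTowerSet u T)
    (he : ∀ A ∈ T, e ∉ A) : ∃ T', IsTowerSet (2 * u) T' ∧ T' ⊆ doubled e T := by
  obtain ⟨f, hf, rfl⟩ := hT
  have hmem : ∀ i < u, f i ∈ (Finset.range u).image f := fun i hi =>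
    Finset.mem_image_of_mem _ (Finset.mem_range.2 hi)
  have he' : ∀ i < u, e ∉ f i := fun i hi => he _ (hmem i hi)
  obtain rfl | rfl | hu : u = 0 ∨ u = 1 ∨ 2 ≤ u := by omega
  · exact ⟨_, ⟨f, isTower_of_le_one (by simp) f, rfl⟩, by simp⟩
  · refine ⟨_, ⟨fun k => adjoin e (f 0) (k = 0), ⟨?_, ?_, by omega, by omega, by omega, by omega⟩,
      rfl⟩, ?_⟩
    · intro i hi j hj h
      have := (adjoin_inj (he' 0 one_pos) (he' 0 one_pos) h).2
      simp only [decide_eq_decide] at this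
      omega
    · intro i hi
      exact adjoin_subset_adjoin subset_rfl (by simp [Bool.le_true])
    · intro A hA
      obtain ⟨k, -, rfl⟩ := Finset.mem_image.1 hA
      exact adjoin_mem_doubled (hmem 0 one_pos) _
  · refine ⟨_, ⟨_, hf.vertical he' hu (Or.inl rfl), rfl⟩, ?_⟩
    intro A hA
    obtain ⟨k, hk, rfl⟩ := Finset.mem_image.1 hA
    exact adjoin_mem_doubled (hmem _ (verticalIndex_lt hu (Finset.mem_range.1 hk))) _

/-- For `b ≥ 3` the two towers come from `IsTower.upper` and `IsTower.lower`. For `b = 1 < a` the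
larger one is the vertical tower without its last set `f 1`, which becomes the tower of size one. -/
theorem IsTowerSet.odd {a b c e : ℕ} {T : Finset (Finset ℕ)} (hT : IsTowerSet c T)
    (he : ∀ A ∈ T, e ∉ A) (hc : a + b = 2 * c) (hba : b ≤ a) (hbo : Odd b) :
    ∃ T₁ T₂, IsTowerSet a T₁ ∧ IsTowerSet b T₂ ∧ Disjoint T₁ T₂ ∧ T₁ ⊆ doubled e T ∧
      T₂ ⊆ doubled e T := by
  obtain ⟨f, hf, rfl⟩ := hT
  have hmem : ∀ i < c, f i ∈ (Finset.range c).image f := fun i hi =>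
    Finset.mem_image_of_mem _ (Finset.mem_range.2 hi)
  have he' : ∀ i < c, e ∉ f i := fun i hi => he _ (hmem i hi)
  obtain ⟨r, hr⟩ := id hbo
  obtain ⟨rfl, rfl⟩ | ⟨rfl, ha⟩ | hb : (b = 1 ∧ a = 1) ∨ (b = 1 ∧ 3 ≤ a) ∨ 3 ≤ b := by omega
  · obtain rfl : c = 1 := by omega
    refine ⟨_, _, ⟨fun _ => adjoin e (f 0) true, isTower_of_le_one le_rfl _, rfl⟩,
      ⟨fun _ => adjoin e (f 0) false, isTower_of_le_one le_rfl _, rfl⟩, ?_, ?_, ?_⟩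
    · simp only [Finset.range_one, Finset.image_singleton, Finset.disjoint_singleton_left,
        Finset.mem_singleton]
      intro h
      simpa using (adjoin_inj (he' 0 one_pos) (he' 0 one_pos) h).2
    · intro A hA
      obtain ⟨k, hk, rfl⟩ := Finset.mem_image.1 hA
      exact adjoin_mem_doubled (hmem 0 one_pos) _
    · intro A hA
      obtain ⟨k, hk, rfl⟩ := Finset.mem_image.1 hA
      exact adjoin_mem_doubled (hmem 0 one_pos) _
  · refine ⟨_, _, ⟨_, hf.vertical (n := a) he' (by omega) (by omega), rfl⟩,
      ⟨fun _ => adjoin e (f 1) false, isTower_of_le_one le_rfl _, rfl⟩, ?_, ?_, ?_⟩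
    · rw [Finset.disjoint_right]
      intro A hA hA'
      obtain ⟨j, -, rfl⟩ := Finset.mem_image.1 hA
      obtain ⟨k, hk, h⟩ := Finset.mem_image.1 hA'
      have hk := Finset.mem_range.1 hk
      have h1 : verticalIndex c (2 * c - 1) = (1, false) := by
        unfold verticalIndex
        rw [if_neg (by omega), if_neg (by omega), if_neg (by omega), if_pos rfl]
      have hlt : (verticalIndex c k).1 < c := verticalIndex_lt (by omega) (by omega)
      obtain ⟨h2, h3⟩ := adjoin_inj (he' _ hlt) (he' 1 (by omega)) h
      have h4 : verticalIndex c k = verticalIndex c (2 * c - 1) := by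
        rw [h1]
        exact Prod.ext (hf.inj _ hlt 1 (by omega) h2) h3
      have := verticalIndex_inj (by omega) (by omega) h4
      omega
    · intro A hA
      obtain ⟨k, hk, rfl⟩ := Finset.mem_image.1 hA
      have hk := Finset.mem_range.1 hk
      exact adjoin_mem_doubled (hmem _ (verticalIndex_lt (by omega) (by omega))) _
    · intro A hA
      obtain ⟨k, hk, rfl⟩ := Finset.mem_image.1 hA
      exact adjoin_mem_doubled (hmem 1 (by omega)) _
  · refine ⟨_, _, ⟨_, hf.upper he' hc hb hbo, rfl⟩,
      ⟨f, hf.lower (by omega) hbo, rfl⟩, ?_, ?_, ?_⟩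
    · rw [Finset.disjoint_right]
      intro A hA hA'
      obtain ⟨j, hj, rfl⟩ := Finset.mem_image.1 hA
      obtain ⟨k, hk, h⟩ := Finset.mem_image.1 hA'
      have hk := Finset.mem_range.1 hk
      have hj := Finset.mem_range.1 hj
      have hlt : (upperIndex b k).1 < c := upperIndex_lt hc hk
      obtain ⟨h2, h3⟩ := adjoin_inj (c := false) (he' _ hlt) (he' j (by omega)) h
      have h4 := hf.inj _ hlt j (by omega) h2
      unfold upperIndex at h3 h4
      split_ifs at h3 h4
      simp only at h4
      omega
    · intro A hA
      obtain ⟨k, hk, rfl⟩ := Finset.mem_image.1 hA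
      exact adjoin_mem_doubled (hmem _ (upperIndex_lt hc (Finset.mem_range.1 hk))) _
    · intro A hA
      obtain ⟨k, hk, rfl⟩ := Finset.mem_image.1 hA
      have hk := Finset.mem_range.1 hk
      exact adjoin_mem_doubled (e := e) (hmem k (by omega)) false

/-! ### Packing disjoint towers into a power set -/

theorem mem_powerset_of_mem_doubled {m : ℕ} {T : Finset (Finset ℕ)} {A : Finset ℕ}
    (hT : T ⊆ (Finset.range m).powerset) (hA : A ∈ doubled m T) :
    A ∈ (Finset.range (m + 1)).powerset := by
  simp only [doubled, Finset.mem_union, Finset.mem_image] at hA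
  rw [Finset.mem_powerset]
  intro x hx
  rw [Finset.mem_range]
  have key : ∀ B ∈ T, ∀ y ∈ B, y < m := fun B hB y hy =>
    Finset.mem_range.1 (Finset.mem_powerset.1 (hT hB) hy)
  rcases hA with hA | ⟨B, hB, rfl⟩
  · have := key A hA x hx
    omega
  · rcases Finset.mem_insert.1 hx with rfl | hx
    · omega
    · have := key B hB x hx
      omega

theorem disjoint_doubled {e : ℕ} {T U : Finset (Finset ℕ)} (hT : ∀ A ∈ T, e ∉ A)
    (hU : ∀ A ∈ U, e ∉ A) (h : Disjoint T U) : Disjoint (doubled e T) (doubled e U) := by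
  rw [Finset.disjoint_left] at h ⊢
  intro A hA hA'
  have key : ∀ W : Finset (Finset ℕ), A ∈ doubled e W → ∃ B ∈ W, ∃ b, A = adjoin e B b := by
    intro W hW
    simp only [doubled, Finset.mem_union, Finset.mem_image] at hW
    rcases hW with hW | ⟨B, hB, rfl⟩
    · exact ⟨A, hW, false, rfl⟩
    · exact ⟨B, hB, true, rfl⟩
  obtain ⟨B, hB, b, rfl⟩ := key T hA
  obtain ⟨C, hC, c, hBC⟩ := key U hA'
  obtain ⟨rfl, -⟩ := adjoin_inj (hT B hB) (hU C hC) hBC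
  exact h hB hC

/-- Disjoint towers of the sizes `s i`, `i ∈ I`, in the family `𝒜`. -/
structure IsTowerPacking {ι : Type*} (I : Finset ι) (s : ι → ℕ) (𝒜 : Finset (Finset ℕ))
    (T : ι → Finset (Finset ℕ)) : Prop where
  tower : ∀ i ∈ I, IsTowerSet (s i) (T i)
  subset : ∀ i ∈ I, T i ⊆ 𝒜
  disjoint : (I : Set ι).PairwiseDisjoint T

theorem IsTowerPacking.update {ι : Type*} [DecidableEq ι] {I : Finset ι} {s : ι → ℕ}
    {𝒜 ℬ 𝒞 : Finset (Finset ℕ)} {T : ι → Finset (Finset ℕ)} {U : Finset (Finset ℕ)} {i : ι}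
    (h : IsTowerPacking I s 𝒜 T) (hi : i ∉ I) (hU : IsTowerSet (s i) U) (hUℬ : U ⊆ ℬ)
    (hd : Disjoint ℬ 𝒜) (h𝒜 : 𝒜 ⊆ 𝒞) (hℬ : ℬ ⊆ 𝒞) :
    IsTowerPacking (insert i I) s 𝒞 (Function.update T i U) where
  tower j hj := by
    rcases eq_or_ne j i with rfl | hji
    · simpa using hU
    · simpa [hji] using h.tower j (Finset.mem_of_mem_insert_of_ne hj hji)
  subset j hj := by
    rcases eq_or_ne j i with rfl | hji
    · simpa using hUℬ.trans hℬ
    · simpa [hji] using (h.subset j (Finset.mem_of_mem_insert_of_ne hj hji)).trans h𝒜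
  disjoint := by
    have key : ∀ j ∈ I, Disjoint U (T j) := fun j hj =>
      Finset.disjoint_of_subset_left hUℬ (Finset.disjoint_of_subset_right (h.subset j hj) hd)
    have hT : ∀ j ∈ I, Function.update T i U j = T j := fun j hj =>
      Function.update_of_ne (ne_of_mem_of_not_mem hj hi) _ _
    rw [Finset.coe_insert, Set.pairwiseDisjoint_insert]
    refine ⟨fun j hj k hk hjk => ?_, fun j hj _ => ?_⟩
    · simpa only [Function.onFun, hT j hj, hT k hk] using h.disjoint hj hk hjk
    · simpa only [Function.update_self, hT j hj] using key j hj

theorem IsTowerPacking.of_insert {ι : Type*} [DecidableEq ι] {J : Finset ι} {s : ι → ℕ} {i : ι}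
    {c : ℕ} {𝒜 : Finset (Finset ℕ)} {T : ι → Finset (Finset ℕ)} (hi : i ∉ J)
    (h : IsTowerPacking (insert i J) (Function.update s i c) 𝒜 T) :
    IsTowerPacking J s 𝒜 T ∧ IsTowerSet c (T i) ∧ T i ⊆ 𝒜 ∧ Disjoint (T i) (J.biUnion T) := by
  have hJ : ∀ j ∈ J, j ∈ insert i J := fun j hj => Finset.mem_insert_of_mem hj
  refine ⟨⟨fun j hj => ?_, fun j hj => h.subset j (hJ j hj), h.disjoint.subset fun j hj => hJ j hj⟩,
    by simpa using h.tower i (Finset.mem_insert_self _ _), h.subset i (Finset.mem_insert_self _ _),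
    ?_⟩
  · simpa [ne_of_mem_of_not_mem hj hi] using h.tower j (hJ j hj)
  · rw [Finset.disjoint_biUnion_right]
    exact fun j hj => h.disjoint (Finset.mem_insert_self _ _) (hJ j hj)
      (ne_of_mem_of_not_mem hj hi).symm

theorem sum_insert_update {ι : Type*} [DecidableEq ι] {J : Finset ι} {i : ι} (hi : i ∉ J)
    (s : ι → ℕ) (c : ℕ) :
    ∑ j ∈ insert i J, Function.update s i c j = c + ∑ j ∈ J, s j := by
  rw [Finset.sum_insert hi, Function.update_self]
  congr 1
  exact Finset.sum_congr rfl fun j hj => Function.update_of_ne (ne_of_mem_of_not_mem hj hi) _ _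

theorem doubled_union (e : ℕ) (T U : Finset (Finset ℕ)) :
    doubled e (T ∪ U) = doubled e T ∪ doubled e U := by
  simp only [doubled, Finset.image_union]
  exact Finset.union_union_union_comm _ _ _ _

/-- Any sizes can be halved such that every packing of the halved sizes yields, after doubling, a
packing of the original ones. -/
theorem exists_halving {ι : Type*} [DecidableEq ι] (s : ι → ℕ) (I : Finset ι) :
    ∃ (J : Finset ι) (s' : ι → ℕ), J ⊆ I ∧ 2 * ∑ j ∈ J, s' j ≤ ∑ i ∈ I, s i + 1 ∧
      ∀ (e : ℕ) (𝒜 : Finset (Finset ℕ)) (T' : ι → Finset (Finset ℕ)), (∀ A ∈ 𝒜, e ∉ A) →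
        IsTowerPacking J s' 𝒜 T' → ∃ T, IsTowerPacking I s (doubled e (J.biUnion T')) T := by
  -- Even sizes are halved one at a time and odd sizes are merged two at a time; at most one odd
  -- size remains and is rounded up, which costs the `+ 1`. Packing into the doubling of the used
  -- sets, rather than of `𝒜`, keeps the towers of different steps disjoint.
  induction I using Finset.strongInduction with
  | H I ih =>
  by_cases heven : ∃ i ∈ I, Even (s i)
  · obtain ⟨i, hi, u, hu⟩ := heven
    obtain ⟨J, s', hJI, hsum, hJ⟩ := ih (I.erase i) (Finset.erase_ssubset hi)
    have hiJ : i ∉ J := fun h => by simpa using hJI h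
    refine ⟨insert i J, Function.update s' i u, ?_, ?_, fun e 𝒜 T' he hT' => ?_⟩
    · exact Finset.insert_subset hi (hJI.trans (Finset.erase_subset _ _))
    · rw [sum_insert_update hiJ, ← Finset.add_sum_erase I s hi]
      omega
    · obtain ⟨h1, h2, h3, h4⟩ := hT'.of_insert hiJ
      obtain ⟨T, hT⟩ := hJ e 𝒜 T' he h1
      obtain ⟨U, hU, hU'⟩ := h2.even (e := e) fun A hA => he A (h3 hA)
      have hd : Disjoint (doubled e (T' i)) (doubled e (J.biUnion T')) :=
        disjoint_doubled (fun A hA => he A (h3 hA))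
          (fun A hA => he A (Finset.biUnion_subset.2 h1.subset hA)) h4
      have := hT.update (i := i) (𝒞 := doubled e ((insert i J).biUnion T')) (by simp)
        (by rwa [hu, ← two_mul]) hU' hd
        (by rw [Finset.biUnion_insert, doubled_union]; exact Finset.subset_union_right)
        (by rw [Finset.biUnion_insert, doubled_union]; exact Finset.subset_union_left)
      rw [Finset.insert_erase hi] at this
      exact ⟨_, this⟩
  · push Not at heven
    have hodd : ∀ i ∈ I, Odd (s i) := fun i hi => Nat.not_even_iff_odd.1 (heven i hi)
    by_cases hpair : ∃ i ∈ I, ∃ j ∈ I, i ≠ j ∧ s j ≤ s i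
    · obtain ⟨i, hi, j, hj, hij, hle⟩ := hpair
      have hj' : j ∈ I.erase i := Finset.mem_erase.2 ⟨hij.symm, hj⟩
      obtain ⟨J, s', hJI, hsum, hJ⟩ := ih ((I.erase i).erase j)
        ((Finset.erase_ssubset hj').trans (Finset.erase_ssubset hi))
      have hiJ : i ∉ J := fun h => by simpa using hJI h
      obtain ⟨p, hp⟩ := hodd i hi
      obtain ⟨q, hq⟩ := hodd j hj
      refine ⟨insert i J, Function.update s' i (p + q + 1), ?_, ?_, fun e 𝒜 T' he hT' => ?_⟩
      · exact Finset.insert_subset hi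
          (hJI.trans ((Finset.erase_subset _ _).trans (Finset.erase_subset _ _)))
      · rw [sum_insert_update hiJ, ← Finset.add_sum_erase I s hi, ← Finset.add_sum_erase _ s hj']
        omega
      · obtain ⟨h1, h2, h3, h4⟩ := hT'.of_insert hiJ
        obtain ⟨T, hT⟩ := hJ e 𝒜 T' he h1
        obtain ⟨U₁, U₂, hU₁, hU₂, hU, hU₁', hU₂'⟩ := h2.odd (e := e) (a := s i) (b := s j)
          (fun A hA => he A (h3 hA)) (by omega) hle (hodd j hj)
        have hd : Disjoint (doubled e (T' i)) (doubled e (J.biUnion T')) :=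
          disjoint_doubled (fun A hA => he A (h3 hA))
            (fun A hA => he A (Finset.biUnion_subset.2 h1.subset hA)) h4
        have hT₂ := hT.update (i := j) (by simp) hU₂ subset_rfl
          (Finset.disjoint_of_subset_left hU₂' hd) Finset.subset_union_right
          Finset.subset_union_left
        have hT₁ := hT₂.update (i := i) (𝒞 := doubled e ((insert i J).biUnion T'))
          (by simp [hij]) hU₁ subset_rfl
          (Finset.disjoint_union_right.2 ⟨hU, Finset.disjoint_of_subset_left hU₁' hd⟩)
          (by
            rw [Finset.biUnion_insert, doubled_union]
            exact Finset.union_subset_union_left hU₂')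
          (by
            rw [Finset.biUnion_insert, doubled_union]
            exact hU₁'.trans Finset.subset_union_left)
        rw [Finset.insert_erase hj', Finset.insert_erase hi] at hT₁
        exact ⟨_, hT₁⟩
    · push Not at hpair
      have hsub : ∀ i ∈ I, ∀ j ∈ I, i = j := by
        intro i hi j hj
        by_contra hij
        have := hpair i hi j hj hij
        have := hpair j hj i hi (Ne.symm hij)
        omega
      refine ⟨I, fun i => (s i + 1) / 2, subset_rfl, ?_, fun e 𝒜 T' he hT' => ?_⟩
      · obtain rfl | ⟨i, hi⟩ := I.eq_empty_or_nonempty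
        · simp
        · obtain rfl : I = {i} := Finset.eq_singleton_iff_unique_mem.2
            ⟨hi, fun j hj => hsub j hj i hi⟩
          simp only [Finset.sum_singleton]
          omega
      · have key : ∀ i ∈ I, ∃ U, IsTowerSet (s i) U ∧ U ⊆ doubled e (I.biUnion T') := by
          intro i hi
          obtain ⟨p, hp⟩ := hodd i hi
          -- The lone odd tower is obtained from a split with a superfluous tower of size one.
          obtain ⟨U, -, hU, -, -, hU', -⟩ := (hT'.tower i hi).odd (e := e) (a := s i) (b := 1)
            (fun A hA => he A (hT'.subset i hi hA)) (by omega) (by omega) odd_one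
          refine ⟨U, hU, hU'.trans ?_⟩
          have hi' : T' i ⊆ I.biUnion T' := Finset.subset_biUnion_of_mem T' hi
          exact Finset.union_subset_union hi' (Finset.image_subset_image hi')
        choose! T hT using key
        exact ⟨T, fun i hi => (hT i hi).1, fun i hi => (hT i hi).2,
          fun i hi j hj hij => absurd (hsub i hi j hj) hij⟩

theorem exists_towerPacking {ι : Type*} [DecidableEq ι] (m : ℕ) :
    ∀ (I : Finset ι) (s : ι → ℕ), ∑ i ∈ I, s i ≤ 2 ^ m →
      ∃ T, IsTowerPacking I s (Finset.range m).powerset T := by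
  induction m with
  | zero =>
    intro I s hs
    have hle : ∀ i ∈ I, s i ≤ 1 := fun i hi =>
      (Finset.single_le_sum (fun _ _ => Nat.zero_le _) hi).trans (by simpa using hs)
    refine ⟨fun i => (Finset.range (s i)).image fun _ => ∅,
      fun i hi => ⟨_, isTower_of_le_one (hle i hi) _, rfl⟩, fun i _ A hA => ?_, ?_⟩
    · obtain ⟨k, -, rfl⟩ := Finset.mem_image.1 hA
      simp
    · intro i hi j hj hij
      have h2 : s i + s j ≤ 1 := by
        rw [← Finset.sum_pair hij]
        refine (Finset.sum_le_sum_of_subset ?_).trans (by simpa using hs)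
        intro x hx
        simp only [Finset.mem_insert, Finset.mem_singleton] at hx
        rcases hx with rfl | rfl
        · exact hi
        · exact hj
      have h0 : s i = 0 ∨ s j = 0 := by omega
      rcases h0 with h0 | h0 <;> simp [Function.onFun, h0]
  | succ m ih =>
    intro I s hs
    obtain ⟨J, s', -, hsum, hJ⟩ := exists_halving s I
    -- As `2 ^ (m + 1)` is even, the rounding term `+ 1` is absorbed.
    obtain ⟨T', hT'⟩ := ih J s' (by rw [pow_succ] at hs; omega)
    have hm : ∀ A ∈ (Finset.range m).powerset, m ∉ A := fun A hA hmA => by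
      simpa using Finset.mem_powerset.1 hA hmA
    obtain ⟨T, hT⟩ := hJ m _ T' hm hT'
    refine ⟨T, hT.tower, fun i hi A hA => ?_, hT.disjoint⟩
    exact mem_powerset_of_mem_doubled (Finset.biUnion_subset.2 hT'.subset) (hT.subset i hi hA)

/-! ### Reduction to spanning spiders -/

theorem mem_of_reachable {V : Type*} {G : SimpleGraph V} {K : Set V}
    (hK : ∀ u ∈ K, ∀ w, G.Adj u w → w ∈ K) {u v : V} (hu : u ∈ K) (h : G.Reachable u v) :
    v ∈ K := by
  obtain ⟨p⟩ := h
  induction p with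
  | nil => exact hu
  | cons hadj _ ih => exact ih (hK _ hu _ hadj)

/-- Every vertex has a neighbor and no edge is isolated: no component has at most two vertices. -/
structure NoSmallComponent {V : Type*} (H : SimpleGraph V) : Prop where
  exists_adj : ∀ v, ∃ u, H.Adj v u
  exists_third : ∀ u v, H.Adj u v → ∃ w, w ≠ u ∧ w ≠ v ∧ (H.Adj u w ∨ H.Adj v w)

theorem noSmallComponent_of_two_lt_ncard {V : Type*} {G : SimpleGraph V}
    (hG : ∀ C : G.ConnectedComponent, 2 < C.supp.ncard) : NoSmallComponent G := by
  have key : ∀ (v : V) (K : Set V), v ∈ K → K.ncard ≤ 2 → K.Finite →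
      ¬ ∀ u ∈ K, ∀ w, G.Adj u w → w ∈ K := by
    intro v K hv hcard hfin hK
    have hsub : (G.connectedComponentMk v).supp ⊆ K := fun w hw =>
      mem_of_reachable hK hv (SimpleGraph.ConnectedComponent.exact hw).symm
    have := hG (G.connectedComponentMk v)
    have := Set.ncard_le_ncard hsub hfin
    omega
  constructor
  · intro v
    by_contra! h
    exact key v {v} rfl (by simp) (Set.finite_singleton v) fun u hu w hw => by
      rw [Set.mem_singleton_iff.1 hu] at hw
      exact absurd hw (h w)
  · intro u v huv
    by_contra! h
    refine key u {u, v} (by simp) ((Set.ncard_insert_le u {v}).trans (by simp)) (by simp)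
      fun a ha w hw => ?_
    by_contra hwK
    simp only [Set.mem_insert_iff, Set.mem_singleton_iff, not_or] at hwK ha
    rcases ha with rfl | rfl
    · exact (h w hwK.1 hwK.2).1 hw
    · exact (h w hwK.1 hwK.2).2 hw

/-- Without the edge `uv`, the vertex `u` is isolated or lies on an isolated edge. -/
def HangsOff {V : Type*} (H : SimpleGraph V) (u v : V) : Prop :=
  (∀ z, H.Adj u z → z = v) ∨
    ∃ w, w ≠ v ∧ H.Adj u w ∧ (∀ z, H.Adj u z → z = v ∨ z = w) ∧ ∀ z, H.Adj w z → z = u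

/-- In a minimal `H`, deleting any edge `uv` creates an isolated vertex or an isolated edge, and
this must contain `u` or `v`. -/
theorem exists_spanning_hangsOff {V : Type*} [Finite V] {G : SimpleGraph V}
    (hG : NoSmallComponent G) :
    ∃ H ≤ G, NoSmallComponent H ∧ ∀ u v, H.Adj u v → HangsOff H u v ∨ HangsOff H v u := by
  obtain ⟨H, hHG, hmin⟩ := (Set.toFinite {H | NoSmallComponent H}).exists_le_minimal hG
  refine ⟨H, hHG, hmin.prop, fun u v huv => ?_⟩
  have hHs : NoSmallComponent H := hmin.prop
  have hlt : ¬ NoSmallComponent (H.deleteEdges {s(u, v)}) := fun h => by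
    have := hmin.le_of_le h (SimpleGraph.deleteEdges_le _)
    have := this huv
    simp at this
  have hdel : ∀ a b, H.Adj a b → s(a, b) ≠ s(u, v) → (H.deleteEdges {s(u, v)}).Adj a b :=
    fun a b h1 h2 => by simpa [h1] using h2
  have hisol : ∀ a b, H.Adj a b → (∀ z, ¬ (H.deleteEdges {s(u, v)}).Adj a z) → s(a, b) = s(u, v) :=
    fun a b h1 h2 => by
      by_contra h3
      exact h2 b (hdel a b h1 h3)
  by_contra! hcon
  obtain ⟨hu, hv⟩ := hcon
  refine hlt ⟨fun x => ?_, fun x y hxy => ?_⟩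
  · by_contra! hx
    obtain ⟨y, hy⟩ := hHs.exists_adj x
    rcases Sym2.eq_iff.1 (hisol x y hy hx) with ⟨rfl, rfl⟩ | ⟨rfl, rfl⟩
    · refine hu (Or.inl fun z hz => ?_)
      rcases Sym2.eq_iff.1 (hisol x z hz hx) with h | h <;> grind
    · refine hv (Or.inl fun z hz => ?_)
      rcases Sym2.eq_iff.1 (hisol x z hz hx) with h | h <;> grind
  · by_contra! hw
    have hxy' : H.Adj x y := SimpleGraph.deleteEdges_le _ hxy
    have hne : s(x, y) ≠ s(u, v) := by
      intro h
      simp [h] at hxy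
    have hnx : ∀ z, H.Adj x z → z = y ∨ s(x, z) = s(u, v) := by
      intro z hz
      by_contra! h
      exact (hw z hz.ne' h.1).1 (hdel x z hz h.2)
    have hny : ∀ z, H.Adj y z → z = x ∨ s(y, z) = s(u, v) := by
      intro z hz
      by_contra! h
      exact (hw z h.1 hz.ne').2 (hdel y z hz h.2)
    -- Here `xy` is isolated once `uv` is deleted. It was not isolated in `H`, so it meets `uv`; the
    -- four possible coincidences of endpoints are all instances of `main`.
    have main : ∀ a b u' v', H.Adj a b → s(a, b) ≠ s(u', v') → H.Adj u' v' →
        (∀ z, H.Adj a z → z = b ∨ s(a, z) = s(u', v')) →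
        (∀ z, H.Adj b z → z = a ∨ s(b, z) = s(u', v')) → a = u' → HangsOff H u' v' := by
      rintro a b u' v' hab hne' huv' ha hb rfl
      have hbv : b ≠ v' := fun h => hne' (by rw [h])
      refine Or.inr ⟨b, hbv, hab, fun z hz => ?_, fun z hz => ?_⟩
      · rcases ha z hz with h | h
        · exact Or.inr h
        · exact Or.inl (by rcases Sym2.eq_iff.1 h with h | h <;> grind)
      · rcases hb z hz with h | h
        · exact h
        · rcases Sym2.eq_iff.1 h with h | h
          · exact absurd h.1 hab.ne'
          · exact h.2
    obtain ⟨w, hwx, hwy, hw'⟩ := hHs.exists_third x y hxy'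
    rcases hw' with h | h
    · rcases Sym2.eq_iff.1 ((hnx w h).resolve_left hwy) with h' | h'
      · exact hu (main x y u v hxy' hne huv hnx hny h'.1)
      · refine hv (main x y v u hxy' (by rwa [Sym2.eq_swap (a := v)]) huv.symm ?_ ?_ h'.1) <;>
          rwa [Sym2.eq_swap (a := v)]
    · rcases Sym2.eq_iff.1 ((hny w h).resolve_left hwx) with h' | h'
      · exact hu (main y x u v hxy'.symm (by rwa [Sym2.eq_swap (a := y)]) huv hny hnx h'.1)
      · refine hv (main y x v u hxy'.symm (by rwa [Sym2.eq_swap (a := y), Sym2.eq_swap (a := v)])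
          huv.symm ?_ ?_ h'.1) <;> rwa [Sym2.eq_swap (a := v)]

/-- Without a center one could walk `v, u, u', u''`, where each vertex hangs off the next but not
conversely. Then `u'` hangs off `u''` with `u` as the far end of its leg, so `u` has no neighbor but
`u'`, contradicting its adjacency to `v`. -/
theorem exists_reachable_center {V : Type*} {H : SimpleGraph V}
    (hH : ∀ u v, H.Adj u v → HangsOff H u v ∨ HangsOff H v u) (v : V) :
    ∃ c, H.Reachable v c ∧ ∀ u, H.Adj c u → HangsOff H u c := by
  by_contra! h
  obtain ⟨u, hvu, hu⟩ := h v (SimpleGraph.Reachable.refl v)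
  obtain ⟨u', huu', hu'⟩ := h u hvu.reachable
  obtain ⟨u'', huu'', hu''⟩ := h u' (hvu.reachable.trans huu'.reachable)
  have h1 := (hH v u hvu).resolve_right hu
  have h2 := (hH u u' huu').resolve_right hu'
  have h3 := (hH u' u'' huu'').resolve_right hu''
  have hne : u' ≠ v := by
    rintro rfl
    exact hu' h1
  have hne' : u'' ≠ u := by
    rintro rfl
    exact hu'' h2
  rcases h2 with h2 | ⟨w, -, -, h2, hw⟩
  · exact hne (h2 v hvu.symm).symm
  · obtain rfl : v = w := (h2 v hvu.symm).resolve_left hne.symm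
    rcases h3 with h3 | ⟨w', -, -, h3, hw'⟩
    · exact hne' (h3 u huu'.symm).symm
    · obtain rfl : u = w' := (h3 u huu'.symm).resolve_left hne'.symm
      exact hne (hw' v hvu.symm).symm

/-- The vertices of a spider: the center, the short legs, the middles and the tips of the long
legs. -/
abbrev SpiderVertex (s b : ℕ) : Type := Unit ⊕ Fin s ⊕ Fin b ⊕ Fin b

/-- The component of `c` is spanned by a spider with center `c`, short legs `x` and long legs from
`y` to `z`. -/
structure IsSpider {V : Type*} (H : SimpleGraph V) (c : V) {s b : ℕ} (x : Fin s → V)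
    (y z : Fin b → V) : Prop where
  short : ∀ i, H.Adj c (x i)
  mid : ∀ j, H.Adj c (y j)
  tip : ∀ j, H.Adj (y j) (z j)
  inj : Function.Injective
    (Sum.elim (fun _ => c) (Sum.elim x (Sum.elim y z)) : SpiderVertex s b → V)
  range : Set.range (Sum.elim (fun _ => c) (Sum.elim x (Sum.elim y z)) : SpiderVertex s b → V) =
    {v | H.Reachable c v}

/-- A neighbor of `c` is a short leg if `c` is its only neighbor; otherwise it is the middle of a
long leg, whose tip `HangsOff` provides. -/
theorem exists_isSpider {V : Type*} [Finite V] {H : SimpleGraph V} {c : V}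
    (hc : ∀ u, H.Adj c u → HangsOff H u c) :
    ∃ (s b : ℕ) (x : Fin s → V) (y z : Fin b → V), IsSpider H c x y z := by
  let Sh := {u // H.Adj c u ∧ ∀ z, H.Adj u z → z = c}
  let Lg := {u // H.Adj c u ∧ ¬ ∀ z, H.Adj u z → z = c}
  have hLg : ∀ u : Lg, ∃ w, w ≠ c ∧ H.Adj u w ∧ (∀ z, H.Adj u z → z = c ∨ z = w) ∧
      ∀ z, H.Adj w z → z = u := fun u => (hc u.1 u.2.1).resolve_left u.2.2
  choose o hoc hou hu ho using hLg
  obtain ⟨s, ⟨eS⟩⟩ := Finite.exists_equiv_fin Sh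
  obtain ⟨b, ⟨eL⟩⟩ := Finite.exists_equiv_fin Lg
  refine ⟨s, b, fun i => eS.symm i, fun j => eL.symm j, fun j => o (eL.symm j),
    fun i => (eS.symm i).2.1, fun j => (eL.symm j).2.1, fun j => hou _, ?_, ?_⟩
  · have hS : ∀ u : Sh, u.1 ≠ c := fun u => u.2.1.ne'
    have hL : ∀ u : Lg, u.1 ≠ c := fun u => u.2.1.ne'
    have hSL : ∀ (u : Sh) (w : Lg), u.1 ≠ w.1 := fun u w h => w.2.2 (h ▸ u.2.2)
    have hSo : ∀ (u : Sh) (w : Lg), u.1 ≠ o w := fun u w h => by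
      have := ho w c (h ▸ u.2.1.symm)
      exact hL w this.symm
    have hLo : ∀ (u w : Lg), u.1 ≠ o w := fun u w h => by
      have := ho w c (h ▸ u.2.1.symm)
      exact hL w this.symm
    have hoo : ∀ (u w : Lg), o u = o w → u = w := fun u w h =>
      Subtype.ext (ho w u (h ▸ (hou u).symm))
    rintro (_ | i | i | i) (_ | j | j | j) h <;> simp only [Sum.elim_inl, Sum.elim_inr] at h
    · rfl
    · exact absurd h.symm (hS _)
    · exact absurd h.symm (hL _)
    · exact absurd h.symm (hoc _)
    · exact absurd h (hS _)
    · rw [eS.symm.injective (Subtype.ext h)]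
    · exact absurd h (hSL _ _)
    · exact absurd h (hSo _ _)
    · exact absurd h (hL _)
    · exact absurd h.symm (hSL _ _)
    · rw [eL.symm.injective (Subtype.ext h)]
    · exact absurd h (hLo _ _)
    · exact absurd h (hoc _)
    · exact absurd h.symm (hSo _ _)
    · exact absurd h.symm (hLo _ _)
    · rw [eL.symm.injective (hoo _ _ h)]
  · apply Set.Subset.antisymm
    · rintro _ ⟨_ | i | i | i, rfl⟩
      · exact SimpleGraph.Reachable.refl _
      · exact (eS.symm i).2.1.reachable
      · exact (eL.symm i).2.1.reachable
      · exact (eL.symm i).2.1.reachable.trans (hou _).reachable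
    · intro v hv
      refine mem_of_reachable (G := H) (u := c) ?_ ⟨Sum.inl (), rfl⟩ hv
      rintro _ ⟨_ | i | i | i, rfl⟩ w hw <;> simp only [Sum.elim_inl, Sum.elim_inr] at hw
      · by_cases h : ∀ z, H.Adj w z → z = c
        · exact ⟨Sum.inr (Sum.inl (eS ⟨w, hw, h⟩)), by simp⟩
        · exact ⟨Sum.inr (Sum.inr (Sum.inl (eL ⟨w, hw, h⟩))), by simp⟩
      · exact ⟨Sum.inl (), ((eS.symm i).2.2 w hw).symm⟩
      · rcases hu _ w hw with h | h
        · exact ⟨Sum.inl (), h.symm⟩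
        · exact ⟨Sum.inr (Sum.inr (Sum.inr i)), h.symm⟩
      · exact ⟨Sum.inr (Sum.inr (Sum.inl i)), (ho _ w hw).symm⟩

/-! ### Labelling spiders by towers -/

/-- A labelling of the spider vertices by the indices of the tower `f` such that the label of each
vertex is covered by the labels of its neighbors. -/
structure IsTowerLabelling (S : ℕ) (f : ℕ → Finset ℕ) {s b : ℕ} (F : SpiderVertex s b → ℕ) :
    Prop where
  lt : ∀ t, F t < S
  inj : Function.Injective F
  center : ∀ a ∈ f (F (Sum.inl ())), (∃ i, a ∈ f (F (Sum.inr (Sum.inl i)))) ∨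
    ∃ j, a ∈ f (F (Sum.inr (Sum.inr (Sum.inl j))))
  short : ∀ i, f (F (Sum.inr (Sum.inl i))) ⊆ f (F (Sum.inl ()))
  mid : ∀ j, f (F (Sum.inr (Sum.inr (Sum.inl j)))) ⊆
    f (F (Sum.inr (Sum.inr (Sum.inr j)))) ∪ f (F (Sum.inl ()))
  tip : ∀ j, f (F (Sum.inr (Sum.inr (Sum.inr j)))) ⊆ f (F (Sum.inr (Sum.inr (Sum.inl j))))

/-- The center gets `f 1` and the first leg `f 0`, `f 2`. The other legs are pairs with the larger
set in the middle, covered by the tip and the center `f 1`. -/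
theorem IsTower.exists_labelling_no_short {b : ℕ} {f : ℕ → Finset ℕ}
    (hf : IsTower (1 + 2 * b) f) (hb : 1 ≤ b) :
    ∃ F : SpiderVertex 0 b → ℕ, IsTowerLabelling (1 + 2 * b) f F := by
  refine ⟨Sum.elim (fun _ => 1) (Sum.elim (fun i => i.elim0) (Sum.elim
    (fun j => if j.1 = 0 then 0 else 2 * j.1 + 2)
    (fun j => if j.1 = 0 then 2 else 2 * j.1 + 1))), ?_, ?_, ?_, fun i => i.elim0, ?_, ?_⟩
  · rintro (_ | i | j | j) <;> simp only [Sum.elim_inl, Sum.elim_inr] <;>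
      first | exact i.elim0 | (try split_ifs) <;> omega
  · rintro (_ | i | j | j) (_ | i' | j' | j') h <;> simp only [Sum.elim_inl, Sum.elim_inr] at h <;>
      first
      | rfl
      | exact i.elim0
      | exact i'.elim0
      | (exfalso; split_ifs at h <;> omega)
      | (congr 4; apply Fin.ext; split_ifs at h <;> omega)
  · intro a ha
    exact Or.inr ⟨⟨0, hb⟩, by simpa using hf.subset_zero 1 (by omega) ha⟩
  · intro j
    simp only [Sum.elim_inl, Sum.elim_inr]
    split_ifs with h
    · rw [Finset.union_comm]
      exact hf.zero_subset (by omega)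
    · exact hf.subset_pair j (by omega) (by omega)
  · intro j
    simp only [Sum.elim_inr, Sum.elim_inl]
    split_ifs with h
    · exact hf.subset_zero 2 (by omega)
    · exact hf.pair_subset j (by omega) (by omega)

/-- The center `f 0` is covered by the short leg `f 1` and the first middle `f 2`. The tip beyond `f
2` gets the last set of the tower, whose size is even here. -/
theorem IsTower.exists_labelling_one_short {b : ℕ} {f : ℕ → Finset ℕ}
    (hf : IsTower (2 + 2 * b) f) (hb : 1 ≤ b) :
    ∃ F : SpiderVertex 1 b → ℕ, IsTowerLabelling (2 + 2 * b) f F := by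
  refine ⟨Sum.elim (fun _ => 0) (Sum.elim (fun _ => 1) (Sum.elim
    (fun j => 2 * j.1 + 2)
    (fun j => if j.1 = 0 then 2 * b + 1 else 2 * j.1 + 1))), ?_, ?_, ?_, fun i => ?_, ?_, ?_⟩
  · rintro (_ | i | j | j) <;> simp only [Sum.elim_inl, Sum.elim_inr] <;>
      (try split_ifs) <;> omega
  · rintro (_ | i | j | j) (_ | i' | j' | j') h <;> simp only [Sum.elim_inl, Sum.elim_inr] at h <;>
      first
      | rfl
      | (exfalso; omega)
      | (exfalso; split_ifs at h <;> omega)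
      | (congr 2; apply Fin.ext; omega)
      | (congr 3; apply Fin.ext; omega)
      | (congr 3; apply Fin.ext; split_ifs at h <;> omega)
  · intro a ha
    rcases Finset.mem_union.1 (hf.zero_subset (by omega) ha) with h | h
    · exact Or.inl ⟨0, h⟩
    · exact Or.inr ⟨⟨0, hb⟩, h⟩
  · exact hf.subset_zero 1 (by omega)
  · intro j
    exact (hf.subset_zero (2 * j.1 + 2) (by omega)).trans Finset.subset_union_right
  · intro j
    simp only [Sum.elim_inr, Sum.elim_inl]
    split_ifs with h
    · have := hf.last_subset (by omega) ⟨1 + b, by ring⟩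
      rw [h]
      convert this using 2
      omega
    · exact hf.pair_subset j (by omega) (by omega)

/-- Two short legs `f 1`, `f 2` already cover the center `f 0`. Long legs take the pairs, and the
remaining short legs take the final sets, which need only lie in `f 0`. -/
theorem IsTower.exists_labelling_two_short {s b : ℕ} {f : ℕ → Finset ℕ}
    (hf : IsTower (1 + s + 2 * b) f) (hs : 2 ≤ s) :
    ∃ F : SpiderVertex s b → ℕ, IsTowerLabelling (1 + s + 2 * b) f F := by
  refine ⟨Sum.elim (fun _ => 0) (Sum.elim (fun i => if i.1 < 2 then i.1 + 1 else 2 * b + 1 + i.1)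
    (Sum.elim (fun j => 2 * j.1 + 4) (fun j => 2 * j.1 + 3))), ?_, ?_, ?_, fun i => ?_, ?_, ?_⟩
  · rintro (_ | i | j | j) <;> simp only [Sum.elim_inl, Sum.elim_inr] <;>
      (try split_ifs) <;> omega
  · rintro (_ | i | j | j) (_ | i' | j' | j') h <;> simp only [Sum.elim_inl, Sum.elim_inr] at h <;>
      first
      | rfl
      | (exfalso; omega)
      | (exfalso; split_ifs at h <;> omega)
      | (congr 3; apply Fin.ext; omega)
      | (congr 2; apply Fin.ext; split_ifs at h <;> omega)
  · intro a ha
    rcases Finset.mem_union.1 (hf.zero_subset (by omega) ha) with h | h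
    · exact Or.inl ⟨⟨0, by omega⟩, by simpa using h⟩
    · exact Or.inl ⟨⟨1, by omega⟩, by simpa using h⟩
  · refine hf.subset_zero _ ?_
    simp only [Sum.elim_inr, Sum.elim_inl]
    split_ifs <;> omega
  · intro j
    refine (hf.subset_zero _ ?_).trans Finset.subset_union_right
    simp only [Sum.elim_inr, Sum.elim_inl]
    omega
  · intro j
    exact hf.pair_subset (j.1 + 1) (by omega) (by omega)

theorem IsTower.exists_labelling {S s b : ℕ} {f : ℕ → Finset ℕ} (hf : IsTower S f)
    (hS : S = 1 + s + 2 * b) (h3 : 3 ≤ S) :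
    ∃ F : SpiderVertex s b → ℕ, IsTowerLabelling S f F := by
  subst hS
  obtain rfl | rfl | hs : s = 0 ∨ s = 1 ∨ 2 ≤ s := by omega
  · exact hf.exists_labelling_no_short (by omega)
  · exact hf.exists_labelling_one_short (by omega)
  · exact hf.exists_labelling_two_short hs

theorem IsSpider.exists_coloring {V : Type*} {H : SimpleGraph V} {c : V} {s b : ℕ} {x : Fin s → V}
    {y z : Fin b → V} (h : IsSpider H c x y z) {T : Finset (Finset ℕ)}
    (hT : IsTowerSet {v | H.Reachable c v}.ncard T) (h3 : 3 ≤ {v | H.Reachable c v}.ncard) :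
    ∃ g : V → Finset ℕ, Set.InjOn g {v | H.Reachable c v} ∧
      (∀ v, H.Reachable c v → g v ∈ T) ∧
      ∀ v, H.Reachable c v → ∀ a ∈ g v, ∃ u, H.Adj v u ∧ a ∈ g u := by
  classical
  obtain ⟨f, hf, rfl⟩ := hT
  have hcard : {v | H.Reachable c v}.ncard = 1 + s + 2 * b := by
    rw [← h.range, ← Set.image_univ, Set.ncard_image_of_injective _ h.inj, Set.ncard_univ,
      Nat.card_eq_fintype_card]
    simp
    ring
  obtain ⟨F, hF⟩ := hf.exists_labelling hcard h3
  let ρ : SpiderVertex s b → V := Sum.elim (fun _ => c) (Sum.elim x (Sum.elim y z))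
  have hinv : ∀ t, Function.invFun ρ (ρ t) = t := Function.leftInverse_invFun h.inj
  have hmem : ∀ v, H.Reachable c v → ∃ t, ρ t = v := fun v hv => by
    have : v ∈ Set.range ρ := h.range ▸ hv
    exact this
  have hval : ∀ t, ∀ a ∈ f (F t), a ∈ f (F (Function.invFun ρ (ρ t))) := fun t a ha => by
    rwa [hinv]
  refine ⟨fun v => f (F (Function.invFun ρ v)), ?_, ?_, ?_⟩
  · intro v hv w hw hvw
    obtain ⟨t, rfl⟩ := hmem v hv
    obtain ⟨t', rfl⟩ := hmem w hw
    simp only [hinv] at hvw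
    rw [hF.inj (hf.inj _ (hF.lt t) _ (hF.lt t') hvw)]
  · intro v hv
    exact Finset.mem_image_of_mem _ (Finset.mem_range.2 (hF.lt _))
  · intro v hv a ha
    obtain ⟨t, rfl⟩ := hmem v hv
    simp only [hinv] at ha
    rcases t with _ | i | j | j
    · rcases hF.center a ha with ⟨i, hi⟩ | ⟨j, hj⟩
      · exact ⟨x i, h.short i, hval (Sum.inr (Sum.inl i)) a hi⟩
      · exact ⟨y j, h.mid j, hval (Sum.inr (Sum.inr (Sum.inl j))) a hj⟩
    · exact ⟨c, (h.short i).symm, hval (Sum.inl ()) a (hF.short i ha)⟩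
    · rcases Finset.mem_union.1 (hF.mid j ha) with h' | h'
      · exact ⟨z j, h.tip j, hval (Sum.inr (Sum.inr (Sum.inr j))) a h'⟩
      · exact ⟨c, (h.mid j).symm, hval (Sum.inl ()) a h'⟩
    · exact ⟨y j, (h.tip j).symm, hval (Sum.inr (Sum.inr (Sum.inl j))) a (hF.tip j ha)⟩

/-! ### From set labels to edge colorings, and the two bounds -/

theorem NoSmallComponent.three_le_ncard {V : Type*} [Finite V] {H : SimpleGraph V}
    (hH : NoSmallComponent H) (c : V) : 3 ≤ {v | H.Reachable c v}.ncard := by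
  obtain ⟨u, hu⟩ := hH.exists_adj c
  obtain ⟨w, hwc, hwu, hw⟩ := hH.exists_third c u hu
  have hw' : H.Reachable c w := by
    rcases hw with hw | hw
    · exact hw.reachable
    · exact hu.reachable.trans hw.reachable
  have hcard : ({c, u, w} : Set V).ncard = 3 := Set.ncard_eq_three.2
    ⟨c, u, w, hu.ne, hwc.symm, hwu.symm, rfl⟩
  rw [← hcard]
  refine Set.ncard_le_ncard ?_ (Set.toFinite _)
  rintro v (rfl | rfl | rfl)
  · exact SimpleGraph.Reachable.refl _
  · exact hu.reachable
  · exact hw'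

theorem NoSmallComponent.exists_covering {V : Type*} [Fintype V] {G : SimpleGraph V}
    (hG : NoSmallComponent G) {m : ℕ} (hm : Fintype.card V ≤ 2 ^ m) :
    ∃ g : V → Finset ℕ, Function.Injective g ∧ (∀ v, g v ⊆ Finset.range m) ∧
      ∀ v, ∀ a ∈ g v, ∃ u, G.Adj v u ∧ a ∈ g u := by
  classical
  obtain ⟨H, hHG, hHs, hH⟩ := exists_spanning_hangsOff hG
  have hcenter : ∀ C : H.ConnectedComponent, ∃ c, H.connectedComponentMk c = C ∧
      ∀ u, H.Adj c u → HangsOff H u c := by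
    intro C
    obtain ⟨v, rfl⟩ := C.exists_rep
    obtain ⟨c, hvc, hc⟩ := exists_reachable_center hH v
    exact ⟨c, SimpleGraph.ConnectedComponent.sound hvc.symm, hc⟩
  choose c hcC hc using hcenter
  have hreach : ∀ C v, H.Reachable (c C) v ↔ H.connectedComponentMk v = C := fun C v => by
    rw [← SimpleGraph.ConnectedComponent.eq, hcC, eq_comm]
  -- The component sizes add up to the number of vertices, so one tower per component can be packed.
  have hsum : ∑ C : H.ConnectedComponent, {v | H.Reachable (c C) v}.ncard ≤ 2 ^ m := by
    refine le_trans (le_of_eq ?_) hm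
    rw [← Finset.card_univ, Finset.card_eq_sum_card_fiberwise (f := H.connectedComponentMk)
      (t := Finset.univ) (by simp)]
    refine Finset.sum_congr rfl fun C _ => ?_
    rw [← Set.ncard_coe_finset]
    congr 1
    ext v
    simp [hreach]
  obtain ⟨T, hT⟩ := exists_towerPacking m Finset.univ _ hsum
  have hcol : ∀ C, ∃ g : V → Finset ℕ, Set.InjOn g {v | H.Reachable (c C) v} ∧
      (∀ v, H.Reachable (c C) v → g v ∈ T C) ∧
      ∀ v, H.Reachable (c C) v → ∀ a ∈ g v, ∃ u, H.Adj v u ∧ a ∈ g u := by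
    intro C
    obtain ⟨s, b, x, y, z, h⟩ := exists_isSpider (hc C)
    exact h.exists_coloring (hT.tower C (Finset.mem_univ _)) (hHs.three_le_ncard _)
  choose g hginj hgT hgcov using hcol
  have hself : ∀ v, H.Reachable (c (H.connectedComponentMk v)) v := fun v => (hreach _ v).2 rfl
  refine ⟨fun v => g (H.connectedComponentMk v) v, fun v w hvw => ?_, fun v => ?_,
    fun v a ha => ?_⟩
  · simp only at hvw
    by_cases hC : H.connectedComponentMk v = H.connectedComponentMk w
    · rw [← hC] at hvw
      exact hginj _ (hself v) ((hreach _ w).2 hC.symm) hvw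
    · have := hT.disjoint (Finset.mem_coe.2 (Finset.mem_univ _))
        (Finset.mem_coe.2 (Finset.mem_univ _)) hC
      exact absurd (hvw ▸ hgT _ w (hself w)) (Finset.disjoint_left.1 this (hgT _ v (hself v)))
  · exact Finset.mem_powerset.1 (hT.subset _ (Finset.mem_univ _) (hgT _ v (hself v)))
  · obtain ⟨u, hu, hau⟩ := hgcov _ v (hself v) a ha
    refine ⟨u, hHG hu, ?_⟩
    simp only
    rwa [← SimpleGraph.ConnectedComponent.sound hu.reachable]

theorem NoSmallComponent.hasUnionVertexDistinguishingColoring {V : Type*} [Fintype V]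
    {G : SimpleGraph V} (hG : NoSmallComponent G) {m : ℕ} (hm : Fintype.card V ≤ 2 ^ m) :
    HasUnionVertexDistinguishingColoring G (m + 1) := by
  obtain ⟨g, hinj, hrange, hcov⟩ := hG.exists_covering hm
  -- The common element `Fin.last m` makes all colors nonempty, even where the intersection of the
  -- endpoint labels is empty or a label is `∅`.
  let col : G.edgeSet → Set (Fin (m + 1)) := fun e =>
    {a | a = Fin.last m ∨ ∀ v ∈ (e : Sym2 V), a.1 ∈ g v}
  have hmem : ∀ v a, a ∈ unionVertexColoring col v ↔ a = Fin.last m ∨ a.1 ∈ g v := by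
    intro v a
    simp only [unionVertexColoring, Set.mem_iUnion, col, Set.mem_ofPred_eq]
    constructor
    · rintro ⟨e, hv, rfl | h⟩
      · exact Or.inl rfl
      · exact Or.inr (h v hv)
    · rintro (rfl | h)
      · obtain ⟨u, hu⟩ := hG.exists_adj v
        exact ⟨⟨s(v, u), hu⟩, by simp, Or.inl rfl⟩
      · obtain ⟨u, hu, hau⟩ := hcov v a.1 h
        refine ⟨⟨s(v, u), hu⟩, by simp, Or.inr fun w hw => ?_⟩
        rcases Sym2.mem_iff.1 hw with rfl | rfl
        · exact h
        · exact hau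
  refine ⟨col, fun e => ⟨Fin.last m, Or.inl rfl⟩, fun v => ⟨Fin.last m, (hmem v _).2 (Or.inl rfl)⟩,
    fun v w hvw => hinj ?_⟩
  have key : ∀ v w, unionVertexColoring col v = unionVertexColoring col w → g v ⊆ g w := by
    intro v w h a ha
    have ham : a < m := Finset.mem_range.1 (hrange v ha)
    have h1 : (⟨a, by omega⟩ : Fin (m + 1)) ∈ unionVertexColoring col w := by
      rw [← h, hmem]
      exact Or.inr ha
    rcases (hmem w _).1 h1 with h2 | h2
    · have := congrArg Fin.val h2
      simp only [Fin.val_last] at this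
      omega
    · exact h2
  exact (key v w hvw).antisymm (key w v hvw.symm)

theorem card_lt_two_pow_of_hasColoring {V : Type*} [Fintype V] {G : SimpleGraph V} {k : ℕ}
    (h : HasUnionVertexDistinguishingColoring G k) : Fintype.card V < 2 ^ k := by
  classical
  obtain ⟨c, hc⟩ := h
  have h1 : Fintype.card V < Fintype.card (Set (Fin k)) :=
    Fintype.card_lt_of_injective_of_notMem _ hc.injective (b := ∅) (by
      rintro ⟨v, hv⟩
      simpa [hv] using hc.vertex_nonempty v)
  simpa using h1

theorem theorem1 {V : Type*} [Fintype V] (G : SimpleGraph V)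
    (hG : ∀ C : G.ConnectedComponent, 2 < C.supp.ncard) :
    (∃ k : ℕ, HasUnionVertexDistinguishingColoring G k) ∧
      (unionVertexDistinguishingIndex G = ⌈Real.logb 2 ((Fintype.card V : ℝ) + 1)⌉₊ ∨
        unionVertexDistinguishingIndex G = ⌈Real.logb 2 ((Fintype.card V : ℝ) + 1)⌉₊ + 1) := by
  set m := ⌈Real.logb 2 ((Fintype.card V : ℝ) + 1)⌉₊ with hm
  -- The `+ 1` inside the logarithm turns `n + 1 ≤ 2 ^ k` into the strict bound, matching the
  -- exclusion of `∅` as a vertex color.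
  have hle : ∀ k : ℕ, m ≤ k ↔ Fintype.card V < 2 ^ k := by
    intro k
    rw [hm, Nat.ceil_le, Real.logb_le_iff_le_rpow one_lt_two (by positivity), Real.rpow_natCast,
      ← Nat.succ_le_iff]
    exact_mod_cast Iff.rfl
  have hcol : HasUnionVertexDistinguishingColoring G (m + 1) :=
    (noSmallComponent_of_two_lt_ncard hG).hasUnionVertexDistinguishingColoring
      ((hle m).1 le_rfl).le
  refine ⟨⟨m + 1, hcol⟩, ?_⟩
  have hub : unionVertexDistinguishingIndex G ≤ m + 1 := Nat.sInf_le hcol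
  have hmem : HasUnionVertexDistinguishingColoring G (unionVertexDistinguishingIndex G) :=
    Nat.sInf_mem (s := {k | HasUnionVertexDistinguishingColoring G k}) ⟨m + 1, hcol⟩
  have hlb : m ≤ unionVertexDistinguishingIndex G :=
    (hle _).2 (card_lt_two_pow_of_hasColoring hmem)
  omega
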